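/- Let $\mathbb{F}$ be a field of characteristic zero, $M$ a finite-dimensional $\mathbb{F}$-vector space, $\Omega\subseteq\mathfrak{gl}(M)$ a Lie algebra of linear maps on $M$, and let $\mathrm{Sub}_\Omega M$ be the lattice of $\Omega$-invariant subspaces of $M$ (join is the sum, meet is the intersection). Two invariant subspaces $A,B$ are called $\Omega$-isomorphic if there is a bijective linear map $\varphi\colon A\to B$ with $\varphi(f(a))=f(\varphi(a))$ for all $a\in A$, $f\in\Omega$. An invariant subspace is irreducible if it is nonzero and contains no invariant subspaces other than $0$ and itself. $\Omega$ is completely reducible in $M$ if $M$ is a direct sum of irreducible invariant subspaces. A bounded lattice is boolean if it is complemented and distributive. Then the following are equivalent: (a) $\mathrm{Sub}_\Omega M$ is finite and boolean. (b) $\mathrm{Sub}_\Omega M$ is finite and complemented. (c) $\Omega$ is completely reducible in $M$, and no two distinct irreducible elements of $\mathrm{Sub}_\Omega M$ are $\Omega$-isomorphic. (d) $\Omega=\Omega_1\oplus A$, where $\Omega_1$ is a semisimple ideal of $\Omega$ (i.e. with zero solvable radical; $\Omega_1=0$ is allowed), $A$ is the centre of $\Omega$, every element of $A$ is a semisimple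 linear map (i.e. its minimal polynomial is a product of pairwise relatively prime irreducible polynomials), and no two distinct irreducible elements of $\mathrm{Sub}_\Omega M$ are $\Omega$-isomorphic. If these equivalent conditions hold, then $M$ has a decomposition $M=M_1\oplus\dots\oplus M_r$ ($r\ge 0$) into irreducible, pairwise non-$\Omega$-isomorphic subspaces $M_j\in\mathrm{Sub}_\Omega M$, and it is unique up to the order of the summands. Moreover $$\mathrm{Sub}_\Omega M=\{M_{i_1}\oplus\dots\oplus M_{i_k}: 1\le i_1<\dots<i_k\le r\}\cup\{0\},$$ and $\mathrm{Sub}_\Omega M$ is isomorphic to the $r$-cube lattice, i.e. the lattice of all subsets of $\{1,\dots,r\}$. -/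

import Mathlib

attribute [local instance 100] LieRing.ofAssociativeRing

namespace LieLinear

variable {F M : Type*} [Field F] [AddCommGroup M] [Module F M]

/-- The lattice of `Ω`-invariant subspaces of `M`, where `Ω` is a Lie algebra of linear maps on `M`
acting by evaluation. Join is the sum, meet is the intersection. -/
abbrev Sub (Ω : LieSubalgebra F (Module.End F M)) : Type _ := LieSubmodule F Ω M

/-- The defining property of the lattice of `Ω`-invariant subspaces. -/
theorem exists_sub_iff (Ω : LieSubalgebra F (Module.End F M)) (p : Submodule F M) :
    (∃ N : Sub Ω, (N : Submodule F M) = p) ↔ ∀ f ∈ Ω, ∀ m ∈ p, f m ∈ p := by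
  constructor
  · rintro ⟨N, rfl⟩ f hf m hm
    exact N.lie_mem (x := (⟨f, hf⟩ : Ω)) hm
  · intro h
    exact ⟨⟨p, fun {x m} hm => h x.1 x.2 m hm⟩, rfl⟩

/-- `A` and `B` are `Ω`-isomorphic: there is a linear bijection `A → B` commuting with every
element of `Ω`. -/
def OmegaIso {Ω : LieSubalgebra F (Module.End F M)} (A B : Sub Ω) : Prop :=
  ∃ φ : A ≃ₗ[F] B, ∀ (f : Ω) (a : A), φ ⁅f, a⁆ = ⁅f, φ a⁆

/-- `A` is irreducible: it is nonzero and its only invariant subspaces are `0` and `A`. -/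
def Irred {Ω : LieSubalgebra F (Module.End F M)} (A : Sub Ω) : Prop :=
  LieModule.IsIrreducible F Ω A

/-- Any two `Ω`-isomorphic irreducible invariant subspaces are equal. -/
def NoIsoIrred (Ω : LieSubalgebra F (Module.End F M)) : Prop :=
  ∀ A B : Sub Ω, Irred A → Irred B → OmegaIso A B → A = B

/-- `Ω` is completely reducible in `M`: `M` is a finite direct sum of irreducible invariant
subspaces (the notion for finite-dimensional `M`). -/
def CompletelyReducible (Ω : LieSubalgebra F (Module.End F M)) : Prop :=
  ∃ (n : ℕ) (N : Fin n → Sub Ω), (∀ i, Irred (N i)) ∧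
    DirectSum.IsInternal fun i => (N i : Submodule F M)

/-- A bounded lattice is boolean if it is complemented and distributive. -/
def IsBooleanLattice (α : Type*) [Lattice α] [BoundedOrder α] : Prop :=
  ComplementedLattice α ∧ ∀ a b c : α, a ⊓ (b ⊔ c) = (a ⊓ b) ⊔ (a ⊓ c)

/-- A linear map is semisimple if its minimal polynomial is a product of pairwise relatively prime
irreducible polynomials. -/
def IsSemisimpleMap (f : Module.End F M) : Prop :=
  ∃ s : Finset (Polynomial F), (∀ p ∈ s, Irreducible p) ∧
    (s : Set (Polynomial F)).Pairwise IsCoprime ∧ minpoly F f = ∏ p ∈ s, p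

/-- `Ω = Ω₁ ⊕ A` with `Ω₁` a semisimple ideal (zero solvable radical) and `A` the centre of `Ω`,
all of whose elements are semisimple maps. -/
def SemisimplePlusCentre (Ω : LieSubalgebra F (Module.End F M)) : Prop :=
  (∃ Ω₁ : LieIdeal F Ω, LieAlgebra.HasTrivialRadical F Ω₁ ∧
    IsCompl Ω₁.toSubmodule (LieAlgebra.center F Ω).toSubmodule) ∧
  ∀ a ∈ LieAlgebra.center F Ω, IsSemisimpleMap (a : Module.End F M)

/-- `M = N 0 ⊕ … ⊕ N (r-1)` with `N i` irreducible and pairwise non-`Ω`-isomorphic. -/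
def IsDecomposition {Ω : LieSubalgebra F (Module.End F M)} {r : ℕ} (N : Fin r → Sub Ω) : Prop :=
  DirectSum.IsInternal (fun i => (N i : Submodule F M)) ∧ (∀ i, Irred (N i)) ∧
    Pairwise fun i j => ¬ OmegaIso (N i) (N j)

end LieLinear

/-! Irreducible invariant subspaces are the atoms of `Sub Ω`, and complete reducibility amounts to
complementedness. In a complemented `Sub Ω` without distinct isomorphic atoms, an atom below `B ⊔
T`, with `B` an atom, equals `B` or lies below `T` (`isAtom_le_sup_atom`). So the atoms are exactly
the summands of any decomposition, and an invariant subspace is determined by the summands it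
contains: the lattice is a finite cube. Conversely, an isomorphism between distinct atoms yields
infinitely many graphs, since `F` is infinite (`noIsoIrred_of_finite`).

That complementedness is equivalent to the structure in (d) is Lie theory. If `Ω = Ω₁ ⊕ A`,
semisimplicity of the commuting maps in `A` gives a projection onto a given `N` that commutes with
`A`. Weyl's theorem for `Ω₁`, in the form `V = V^L + L·V` proved with Casimir elements, replaces it
by one that also commutes with `Ω₁`; its kernel is the complement. For the converse, an ideal of
nilpotent maps vanishes by complete reducibility, and a trace argument (`eq_bot_of_le_lie`) produces
such ideals. Hence the radical is central, the centre meets `[Ω,Ω]` trivially, and a Killing form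
dimension count gives `Ω = [Ω,Ω] ⊕ Z(Ω)`. -/

namespace LieLinear

/-! ### Lattice theory: atoms, complements and the cube of summands. -/

section Lattice

variable {F M : Type*} [Field F] [AddCommGroup M] [Module F M]
  {Ω : LieSubalgebra F (Module.End F M)}

theorem mem_of_mem {N : Sub Ω} {f : Module.End F M} (hf : f ∈ Ω) {m : M} (hm : m ∈ N) :
    f m ∈ N :=
  N.lie_mem (x := (⟨f, hf⟩ : Ω)) hm

/-- The invariant subspaces of `A` are the invariant subspaces of `M` contained in `A`. -/
def subOrderIsoIic (A : Sub Ω) : LieSubmodule F Ω A ≃o Set.Iic A where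
  toFun N := ⟨N.map A.incl, LieSubmodule.map_incl_le⟩
  invFun N := N.1.comap A.incl
  left_inv N := LieSubmodule.comap_map_eq _ _ A.ker_incl
  right_inv N := Subtype.ext <| by
    simpa [LieSubmodule.map_comap_incl] using Set.mem_Iic.1 N.2
  map_rel_iff' {N N'} := by
    change N.map A.incl ≤ N'.map A.incl ↔ N ≤ N'
    refine ⟨fun h x hx => ?_, fun h => LieSubmodule.map_mono h⟩
    obtain ⟨y, hy, hyx⟩ := (LieSubmodule.mem_map _).1 (h (LieSubmodule.mem_map_of_mem hx))
    rwa [← Subtype.ext (a1 := y) (a2 := x) hyx]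

theorem irred_iff_isAtom (A : Sub Ω) : Irred A ↔ IsAtom A := by
  rw [← Set.isSimpleOrder_Iic_iff_isAtom]
  exact (subOrderIsoIic A).isSimpleOrder_iff

theorem omegaIso_refl (A : Sub Ω) : OmegaIso A A := ⟨LinearEquiv.refl F A, fun _ _ => rfl⟩

/-- Two common complements of an invariant subspace are `Ω`-isomorphic. -/
theorem omegaIso_of_isCompl {A B T : Sub Ω} (hA : IsCompl A T) (hB : IsCompl B T) :
    OmegaIso A B := by
  have hA' := (LieSubmodule.isCompl_toSubmodule).2 hA
  have hB' := (LieSubmodule.isCompl_toSubmodule).2 hB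
  let φ : A ≃ₗ[F] B := (Submodule.quotientEquivOfIsCompl _ _ hA'.symm).symm.trans
    (Submodule.quotientEquivOfIsCompl _ _ hB'.symm)
  -- `φ` moves points along `T`, so `φ ⁅f, a⁆ - ⁅f, φ a⁆` lies in `B ⊓ T = ⊥`.
  have hφ (a : A) : (a : M) - φ a ∈ T := by
    have h := Submodule.mk_quotientEquivOfIsCompl_apply hB'.symm
      ((Submodule.quotientEquivOfIsCompl _ _ hA'.symm).symm a)
    exact (Submodule.Quotient.eq _).1 h.symm
  refine ⟨φ, fun f a => Subtype.ext <| sub_eq_zero.1 ?_⟩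
  have h1 := hφ ⁅f, a⁆
  have h2 := T.lie_mem (x := f) (hφ a)
  rw [lie_sub] at h2
  have h3 := T.sub_mem h2 h1
  rw [LieSubmodule.coe_bracket, sub_sub_sub_cancel_left, ← LieSubmodule.coe_bracket] at h3
  have := hB.disjoint.le_bot
    ((LieSubmodule.mem_inf _ _ _).2 ⟨B.sub_mem (φ ⁅f, a⁆).2 (⁅f, φ a⁆).2, h3⟩)
  simpa using this

/-- If `A` is not below `T`, then `A ⊔ T = B ⊔ T` because `B ⊔ T` covers `T`. For a complement `Q`
of this join, `T ⊔ Q` is a common complement of `A` and `B`, so they are isomorphic, hence equal. -/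
theorem isAtom_le_sup_atom {T A B : Sub Ω} [ComplementedLattice (Sub Ω)] (hΩ : NoIsoIrred Ω)
    (hA : IsAtom A) (hB : IsAtom B) (h : A ≤ B ⊔ T) : A = B ∨ A ≤ T := by
  refine or_iff_not_imp_right.2 fun hAT => ?_
  have hAT' : Disjoint A T := hA.not_le_iff_disjoint.1 hAT
  have hBT : Disjoint B T :=
    hB.not_le_iff_disjoint.1 fun hBT => hAT (h.trans (sup_le hBT le_rfl))
  have hsup : A ⊔ T = B ⊔ T := by
    have hcov : T ⋖ B ⊔ T := covBy_sup_of_inf_covBy_left (hBT.eq_bot ▸ hB.bot_covBy)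
    exact (hcov.eq_or_eq le_sup_right (sup_le h le_sup_right)).resolve_left
      fun h => hAT (h ▸ le_sup_left)
  obtain ⟨Q, hQ⟩ := exists_isCompl (B ⊔ T)
  refine hΩ A B ((irred_iff_isAtom A).2 hA) ((irred_iff_isAtom B).2 hB)
    (omegaIso_of_isCompl (T := T ⊔ Q) ?_ ?_)
  · refine ⟨hAT'.disjoint_sup_right_of_disjoint_sup_left (hsup ▸ hQ.disjoint), ?_⟩
    rw [codisjoint_iff, ← sup_assoc, hsup, hQ.sup_eq_top]
  · refine ⟨hBT.disjoint_sup_right_of_disjoint_sup_left hQ.disjoint, ?_⟩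
    rw [codisjoint_iff, ← sup_assoc, hQ.sup_eq_top]

theorem isAtom_mem_of_le_sup [ComplementedLattice (Sub Ω)] (hΩ : NoIsoIrred Ω)
    {A : Sub Ω} (hA : IsAtom A) (s : Finset (Sub Ω)) (hs : ∀ B ∈ s, IsAtom B)
    (h : A ≤ s.sup id) : A ∈ s := by
  classical
  induction s using Finset.induction_on with
  | empty => exact absurd (le_bot_iff.1 h) hA.1
  | insert B s _ ih =>
    rw [Finset.sup_insert] at h
    rcases isAtom_le_sup_atom hΩ hA (hs B (by simp)) h with rfl | h
    · simp
    · exact Finset.mem_insert_of_mem (ih (fun B hB => hs B (by simp [hB])) h)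

theorem isInternal_iff (r : ℕ) (N : Fin r → Sub Ω) :
    DirectSum.IsInternal (fun i => (N i : Submodule F M)) ↔ iSupIndep N ∧ ⨆ i, N i = ⊤ := by
  rw [DirectSum.isInternal_submodule_iff_iSupIndep_and_iSup_eq_top,
    LieSubmodule.iSupIndep_toSubmodule, ← LieSubmodule.iSup_toSubmodule,
    LieSubmodule.toSubmodule_eq_top]

theorem CompletelyReducible.complementedLattice (h : CompletelyReducible Ω) :
    ComplementedLattice (Sub Ω) := by
  obtain ⟨n, N, hN, hint⟩ := h
  refine complementedLattice_of_sSup_atoms_eq_top (top_unique ?_)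
  rw [← ((isInternal_iff n N).1 hint).2]
  exact iSup_le fun i => le_sSup ((irred_iff_isAtom _).1 (hN i))

theorem completelyReducible_of_complementedLattice [FiniteDimensional F M]
    [ComplementedLattice (Sub Ω)] : CompletelyReducible Ω := by
  obtain ⟨s, hs, htop, hatom⟩ :=
    exists_sSupIndep_of_sSup_atoms_eq_top (α := Sub Ω) sSup_atoms_eq_top
  have hfin : s.Finite := WellFoundedGT.finite_of_sSupIndep hs
  have := hfin.to_subtype
  obtain ⟨n, ⟨e⟩⟩ := Finite.exists_equiv_fin s
  refine ⟨n, fun i => (e.symm i : Sub Ω), fun i => (irred_iff_isAtom _).2 (hatom (e.symm i).2),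
    (isInternal_iff _ _).2 ⟨?_, ?_⟩⟩
  · exact ((sSupIndep_iff _).1 hs).comp e.symm.injective
  · rw [e.symm.iSup_comp (g := fun x : s => (x : Sub Ω)), ← sSup_eq_iSup', htop]

/-- The decomposition of `M` into pairwise non-isomorphic irreducible subspaces. -/
theorem exists_isDecomposition (h : CompletelyReducible Ω) (hΩ : NoIsoIrred Ω) :
    ∃ (r : ℕ) (N : Fin r → Sub Ω), IsDecomposition N := by
  obtain ⟨n, N, hN, hint⟩ := h
  refine ⟨n, N, hint, hN, fun i j hij hiso => ?_⟩
  have h := hΩ _ _ (hN i) (hN j) hiso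
  have hd := (((isInternal_iff n N).1 hint).1).pairwiseDisjoint hij
  rw [Function.onFun, h, disjoint_self] at hd
  exact ((irred_iff_isAtom _).1 (hN j)).1 hd

section Decomposition

variable {r : ℕ} {N : Fin r → Sub Ω}

theorem IsDecomposition.isAtom (hN : IsDecomposition N) (i : Fin r) : IsAtom (N i) :=
  (irred_iff_isAtom _).1 (hN.2.1 i)

theorem IsDecomposition.injective (hN : IsDecomposition N) : Function.Injective N :=
  fun _ _ hij => by_contra fun h => hN.2.2 h (hij ▸ omegaIso_refl _)

theorem IsDecomposition.iSup_eq_top (hN : IsDecomposition N) : ⨆ i, N i = ⊤ :=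
  ((isInternal_iff r N).1 hN.1).2

theorem IsDecomposition.exists_eq_of_isAtom_le (hN : IsDecomposition N) (hΩ : NoIsoIrred Ω)
    {A : Sub Ω} (hA : IsAtom A) (I : Set (Fin r)) (h : A ≤ ⨆ i ∈ I, N i) : ∃ i ∈ I, A = N i := by
  classical
  have : ComplementedLattice (Sub Ω) :=
    CompletelyReducible.complementedLattice ⟨r, N, hN.2.1, hN.1⟩
  have h' : A ≤ (I.toFinset.image N).sup id := by
    rw [Finset.sup_image, Finset.sup_eq_iSup]
    simpa using h
  have := isAtom_mem_of_le_sup hΩ hA (I.toFinset.image N)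
    (by simpa using fun i _ => hN.isAtom i) h'
  simpa [eq_comm] using this

/-- The lattice of invariant subspaces is the lattice of subsets of the set of irreducible
summands. -/
def IsDecomposition.orderIso (hN : IsDecomposition N) (hΩ : NoIsoIrred Ω) :
    Sub Ω ≃o Set (Fin r) where
  toFun A := {i | N i ≤ A}
  invFun I := ⨆ i ∈ I, N i
  left_inv A := by
    have : ComplementedLattice (Sub Ω) :=
      CompletelyReducible.complementedLattice ⟨r, N, hN.2.1, hN.1⟩
    refine le_antisymm (iSup₂_le fun i hi => hi) ?_
    conv_lhs => rw [← sSup_atoms_le_eq A]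
    refine sSup_le fun B hB => ?_
    obtain ⟨i, -, rfl⟩ := hN.exists_eq_of_isAtom_le hΩ hB.1 Set.univ
      (by simp [hN.iSup_eq_top])
    exact le_iSup₂ (f := fun i (_ : i ∈ {i | N i ≤ A}) => N i) i hB.2
  right_inv I := by
    ext i
    refine ⟨fun h => ?_, fun h => le_iSup₂ (f := fun i (_ : i ∈ I) => N i) i h⟩
    obtain ⟨j, hj, hij⟩ := hN.exists_eq_of_isAtom_le hΩ (hN.isAtom i) I h
    exact hN.injective hij ▸ hj
  map_rel_iff' {A B} := by
    have : ComplementedLattice (Sub Ω) :=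
      CompletelyReducible.complementedLattice ⟨r, N, hN.2.1, hN.1⟩
    refine ⟨fun h => ?_, fun h i hi => le_trans hi h⟩
    rw [← sSup_atoms_le_eq A]
    refine sSup_le fun C hC => ?_
    obtain ⟨i, -, rfl⟩ := hN.exists_eq_of_isAtom_le hΩ hC.1 Set.univ
      (by simp [hN.iSup_eq_top])
    exact h hC.2

theorem IsDecomposition.exists_equiv (hN : IsDecomposition N) (hΩ : NoIsoIrred Ω)
    {s : ℕ} {P : Fin s → Sub Ω} (hP : IsDecomposition P) :
    ∃ e : Fin s ≃ Fin r, ∀ i, P i = N (e i) := by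
  choose e he using fun i => hN.exists_eq_of_isAtom_le hΩ (hP.isAtom i) Set.univ
    (by simp [hN.iSup_eq_top])
  refine ⟨Equiv.ofBijective e ⟨fun i j hij => hP.injective ?_, fun j => ?_⟩, fun i => (he i).2⟩
  · rw [(he i).2, (he j).2, hij]
  · obtain ⟨i, -, hi⟩ := hP.exists_eq_of_isAtom_le hΩ (hN.isAtom j) Set.univ
      (by simp [hP.iSup_eq_top])
    exact ⟨i, hN.injective ((he i).2.symm.trans hi.symm)⟩

end Decomposition

theorem noIsoIrred_of_finite [CharZero F] [Finite (Sub Ω)] : NoIsoIrred Ω := by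
  rintro A B hA hB ⟨φ, hφ⟩
  rw [irred_iff_isAtom] at hA hB
  by_contra hne
  have hd : Disjoint A B := hA.disjoint_of_ne hB hne
  -- The graph of `c • φ` inside `A ⊕ B`. Distinct scalars give distinct graphs, as `A ⊓ B = ⊥` and
  -- `φ` is injective.
  let G (c : F) : Sub Ω :=
    { LinearMap.range ((A : Submodule F M).subtype +
        c • (B : Submodule F M).subtype ∘ₗ φ.toLinearMap) with
      lie_mem := by
        rintro f _ ⟨a, rfl⟩
        refine ⟨(⁅f, (a : A)⁆ : A), ?_⟩
        have := congrArg (fun b : B => (b : M)) (hφ f a)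
        simp only [LieSubmodule.coe_bracket] at this
        simp [this] }
  obtain ⟨c, d, hcd, hG⟩ := Finite.exists_ne_map_eq_of_infinite G
  obtain ⟨a, ha, ha0⟩ := Submodule.exists_mem_ne_zero_of_ne_bot
    ((LieSubmodule.toSubmodule_eq_bot A).not.2 hA.1)
  have : (a : M) + c • (φ ⟨a, ha⟩ : M) ∈ G d := hG ▸ ⟨⟨a, ha⟩, rfl⟩
  obtain ⟨⟨b, hb⟩, hab⟩ := this
  have hab' : b + d • (φ ⟨b, hb⟩ : M) = a + c • (φ ⟨a, ha⟩ : M) := hab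
  have hsub : b - a = c • (φ ⟨a, ha⟩ : M) - d • (φ ⟨b, hb⟩ : M) := by
    rw [sub_eq_sub_iff_add_eq_add, hab', add_comm]
  have h0 := hd.le_bot ((LieSubmodule.mem_inf _ _ _).2 ⟨A.sub_mem hb ha,
    hsub ▸ B.sub_mem (B.smul_mem c (φ _).2) (B.smul_mem d (φ _).2)⟩)
  obtain rfl : b = a := sub_eq_zero.1 ((LieSubmodule.mem_bot _).1 h0)
  rw [sub_self, ← sub_smul, eq_comm, smul_eq_zero, sub_eq_zero] at hsub
  have hb0 := hsub.resolve_left hcd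
  simp at hb0
  exact ha0 hb0

end Lattice

/-! ### Weyl's theorem over a field of characteristic zero. -/

section Weyl

open LieModule LieAlgebra Module

variable {F L V : Type*} [Field F] [LieRing L] [LieAlgebra F L] [FiniteDimensional F L]
  [AddCommGroup V] [Module F V] [LieRingModule L V] [LieModule F L V]

/-- A Lie algebra with nondegenerate Killing form is perfect. -/
theorem lie_top_top_eq_top [IsKilling F L] :
    ⁅(⊤ : LieIdeal F L), (⊤ : LieIdeal F L)⁆ = ⊤ := by
  have hc := LieIdeal.isCompl_killingCompl ⁅(⊤ : LieIdeal F L), (⊤ : LieIdeal F L)⁆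
  suffices h : LieIdeal.killingCompl F L ⁅(⊤ : LieIdeal F L), (⊤ : LieIdeal F L)⁆ = ⊥ by
    rw [h] at hc
    exact eq_top_of_isCompl_bot hc
  rw [eq_bot_iff]
  intro x hx
  rw [LieIdeal.mem_killingCompl] at hx
  suffices h : x ∈ center F L by simpa using h
  refine (mem_maxTrivSubmodule F L L x).2 fun y => ?_
  -- By invariance, pairing `⁅y, x⁆` with `z` is, up to sign, pairing `⁅y, z⁆` with `x`, which is
  -- orthogonal to `[L, L]`.
  refine (IsKilling.killingForm_nondegenerate F L).2 _ fun z => ?_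
  rw [← neg_eq_zero, ← LieModule.traceForm_apply_lie_apply']
  have := hx ⁅y, z⁆ (LieSubmodule.lie_mem_lie (LieSubmodule.mem_top y) (LieSubmodule.mem_top z))
  exact this

/-- Casimir element of the trace form on an ideal where that form is nondegenerate. -/
theorem exists_casimir (J : LieIdeal F L)
    (hJ : ((traceForm F L V).restrict J.toSubmodule).Nondegenerate) :
    ∃ c : Module.End F V, (∀ (x : L) (v : V), c ⁅x, v⁆ = ⁅x, c v⁆) ∧
      LinearMap.trace F V c = finrank F J ∧
      ∀ v, c v ∈ ⁅(⊤ : LieIdeal F L), (⊤ : LieSubmodule F L V)⁆ := by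
  classical
  set B := (traceForm F L V).restrict J.toSubmodule with hBdef
  have hsymm : LinearMap.BilinForm.IsSymm B := ⟨fun x y => traceForm_comm F L V x y⟩
  let b := Module.finBasis F J.toSubmodule
  let d := B.dualBasis hJ b
  let φ : L →ₗ[F] Module.End F V := (toEnd F L V : L →ₗ[F] Module.End F V)
  have hb (y : J.toSubmodule) : y = ∑ j, B y (d j) • b j := by
    have h := (B.dualBasis hJ d).sum_repr y
    simp only [LinearMap.BilinForm.dualBasis_repr_apply] at h
    rw [LinearMap.BilinForm.dualBasis_dualBasis hJ hsymm b] at h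
    exact h.symm
  have hd (y : J.toSubmodule) : y = ∑ j, B y (b j) • d j := by
    have h := d.sum_repr y
    simp only [d, LinearMap.BilinForm.dualBasis_repr_apply] at h
    exact h.symm
  let T (x : L) (y : J.toSubmodule) : J.toSubmodule := ⟨⁅x, (y : L)⁆, J.lie_mem y.2⟩
  have hT (x : L) (y z : J.toSubmodule) : B (T x y) z = - B (T x z) y := by
    rw [hsymm.eq (T x z)]
    exact traceForm_apply_lie_apply' F L V x y z
  refine ⟨∑ i, φ (b i) * φ (d i), fun x v => ?_, ?_, fun v => ?_⟩
  -- The commutator of `x` with the Casimir element. Expanded in the dual bases, its two halves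
  -- cancel by the skewness `hT`.
  · have key : ∑ i, (φ (T x (b i)) * φ (d i) + φ (b i) * φ (T x (d i))) = 0 := by
      have h1 (i) : φ (T x (b i)) = ∑ j, B (T x (b i)) (d j) • φ (b j) := by
        conv_lhs => rw [hb (T x (b i))]
        simp
      have h2 (i) : φ (T x (d i)) = ∑ j, B (T x (d i)) (b j) • φ (d j) := by
        conv_lhs => rw [hd (T x (d i))]
        simp
      simp only [h1, h2, Finset.sum_add_distrib, Finset.sum_mul, Finset.mul_sum,
        smul_mul_assoc, mul_smul_comm]
      rw [Finset.sum_comm, ← Finset.sum_add_distrib]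
      refine Finset.sum_eq_zero fun i _ => ?_
      rw [← Finset.sum_add_distrib]
      refine Finset.sum_eq_zero fun j _ => ?_
      rw [hT x (d i), neg_smul, add_neg_cancel]
    have key' := LinearMap.congr_fun key v
    have hφ (y : L) (w : V) : φ y w = ⁅y, w⁆ := rfl
    simp only [LinearMap.sum_apply, LinearMap.add_apply, Module.End.mul_apply, hφ, T,
      LinearMap.zero_apply, lie_lie] at key'
    simp only [LinearMap.sum_apply, Module.End.mul_apply, hφ, lie_sum]
    rw [eq_comm, ← sub_eq_zero, ← Finset.sum_sub_distrib, ← key']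
    refine Finset.sum_congr rfl fun i _ => ?_
    simp only [lie_sub]
    abel
  · rw [map_sum]
    have h (i) : LinearMap.trace F V (φ (b i) * φ (d i)) = 1 := by
      have := LinearMap.BilinForm.apply_dualBasis_right hJ hsymm b i i
      rw [if_pos rfl] at this
      exact this
    simp [h]
    rfl
  · rw [LinearMap.sum_apply]
    refine sum_mem fun i _ => ?_
    exact LieSubmodule.lie_mem_lie (LieSubmodule.mem_top _) (LieSubmodule.mem_top _)

variable [CharZero F] [IsKilling F L]

/-- A vanishing trace form makes `[L, L] = L` act nilpotently. Perfectness also gives `L·V ≤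
L·(L·V)`, so `L·V` lies in every term of the lower central series and is zero. -/
theorem isTrivial_of_traceForm_eq_zero [FiniteDimensional F V] (h : traceForm F L V = 0)
    (x : L) (v : V) : ⁅x, v⁆ = 0 := by
  have hn := isNilpotent_derivedSeries_of_traceForm_eq_zero h
  rw [isNilpotent_iff_forall' (R := F)] at hn
  have hD : derivedSeries F L 1 = ⊤ := lie_top_top_eq_top
  have hn' : LieModule.IsNilpotent L V := by
    rw [isNilpotent_iff_forall' (R := F)]
    exact fun x => hn ⟨x, hD ▸ LieSubmodule.mem_top x⟩
  set N : LieSubmodule F L V := ⁅(⊤ : LieIdeal F L), (⊤ : LieSubmodule F L V)⁆ with hN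
  have hNN : N ≤ ⁅(⊤ : LieIdeal F L), N⁆ := by
    conv_lhs => rw [hN, ← lie_top_top_eq_top]
    refine (LieSubmodule.lie_le_iff _ _ _).2 fun x hx m _ => ?_
    rw [← LieSubmodule.mem_toSubmodule,
      LieSubmodule.lieIdeal_oper_eq_linear_span'] at hx
    induction hx using Submodule.span_induction with
    | mem x hx =>
      obtain ⟨y, -, z, -, rfl⟩ := hx
      have h (y : L) (m : V) (hm : m ∈ N) : ⁅y, m⁆ ∈ ⁅(⊤ : LieIdeal F L), N⁆ :=
        LieSubmodule.lie_mem_lie (LieSubmodule.mem_top _) hm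
      have h' (y : L) (m : V) : ⁅y, m⁆ ∈ N :=
        LieSubmodule.lie_mem_lie (LieSubmodule.mem_top _) (LieSubmodule.mem_top _)
      rw [lie_lie]
      exact sub_mem (h _ _ (h' _ _)) (h _ _ (h' _ _))
    | zero => simp
    | add x y _ _ hx hy => rw [add_lie]; exact add_mem hx hy
    | smul a x _ hx => rw [smul_lie]; exact Submodule.smul_mem _ a hx
  have hle (k : ℕ) : N ≤ lowerCentralSeries F L V k := by
    induction k with
    | zero => simp
    | succ k ih =>
      rw [LieModule.lowerCentralSeries_succ]
      exact hNN.trans (LieSubmodule.mono_lie_right _ ih)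
  obtain ⟨k, hk⟩ := LieModule.IsNilpotent.nilpotent F L V
  have : ⁅x, v⁆ ∈ N := LieSubmodule.lie_mem_lie (LieSubmodule.mem_top _) (LieSubmodule.mem_top _)
  simpa [hk] using hle k this

/-- The radical of the trace form of a representation. -/
noncomputable def traceFormKer (F L V : Type*) [Field F] [LieRing L] [LieAlgebra F L]
    [AddCommGroup V] [Module F V] [LieRingModule L V] [LieModule F L V] : LieIdeal F L :=
  { LinearMap.ker (traceForm F L V) with
    lie_mem := by
      intro x y hy
      ext z
      have hy' : traceForm F L V y = 0 := hy
      change traceForm F L V ⁅x, y⁆ z = 0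
      rw [traceForm_apply_lie_apply', hy', LinearMap.zero_apply, neg_zero] }

/-- The trace form is nondegenerate on the Killing complement `J` of its kernel. The Casimir element
of `J` has trace `dim J ≠ 0`, so in characteristic zero it is not nilpotent. -/
theorem exists_endomorphism_of_traceForm_ne_zero (h : traceForm F L V ≠ 0) :
    ∃ c : Module.End F V, (∀ (x : L) (v : V), c ⁅x, v⁆ = ⁅x, c v⁆) ∧ ¬ IsNilpotent c ∧
      ∀ v, c v ∈ ⁅(⊤ : LieIdeal F L), (⊤ : LieSubmodule F L V)⁆ := by
  set K := traceFormKer F L V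
  have hK := LieIdeal.isCompl_killingCompl K
  set J := LieIdeal.killingCompl F L K
  have hKz (x : L) (hx : x ∈ K) (y : L) : traceForm F L V x y = 0 := by
    have : traceForm F L V x = 0 := hx
    rw [this, LinearMap.zero_apply]
  have hnd : ((traceForm F L V).restrict J.toSubmodule).Nondegenerate := by
    have hr : LinearMap.IsRefl ((traceForm F L V).restrict J.toSubmodule) := by
      intro x y hxy
      exact (traceForm_comm F L V _ _).trans hxy
    refine hr.nondegenerate_iff_separatingLeft.2 fun x hx => ?_
    have hxK : (x : L) ∈ K := by
      change traceForm F L V x = 0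
      ext z
      obtain ⟨k, hk, j, hj, rfl⟩ := (LieSubmodule.mem_sup _ _ _).1
        (hK.sup_eq_top ▸ LieSubmodule.mem_top z : z ∈ K ⊔ J)
      have := hx ⟨j, hj⟩
      rw [map_add, traceForm_comm F L V x k, hKz k hk, zero_add]
      exact this
    have := hK.disjoint.le_bot ((LieSubmodule.mem_inf _ _ _).2 ⟨hxK, x.2⟩)
    exact Subtype.ext (by simpa using this)
  obtain ⟨c, hc1, hc2, hc3⟩ := exists_casimir J hnd
  refine ⟨c, hc1, fun hn => ?_, hc3⟩
  have h0 := (LinearMap.isNilpotent_trace_of_isNilpotent hn).eq_zero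
  rw [hc2, Nat.cast_eq_zero] at h0
  have hJ : J = ⊥ := (LieSubmodule.toSubmodule_eq_bot J).1 (Submodule.finrank_eq_zero.1 h0)
  rw [hJ] at hK
  refine h (LinearMap.ext fun x => ?_)
  exact (eq_top_of_isCompl_bot hK ▸ LieSubmodule.mem_top x : x ∈ K)

/-- The module form of Weyl's theorem. -/
theorem maxTrivSubmodule_sup_lie_eq_top [FiniteDimensional F V] :
    maxTrivSubmodule F L V ⊔ ⁅(⊤ : LieIdeal F L), (⊤ : LieSubmodule F L V)⁆ = ⊤ := by
  induction hn : finrank F V using Nat.strong_induction_on generalizing V with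
  | _ n ih =>
  subst hn
  by_cases h : traceForm F L V = 0
  · refine top_unique (le_sup_of_le_left fun v _ => ?_)
    exact (mem_maxTrivSubmodule F L V v).2 fun x => isTrivial_of_traceForm_eq_zero h x v
  obtain ⟨c, hc, hnil, hcL⟩ := exists_endomorphism_of_traceForm_ne_zero h
  -- Fitting decomposition for `c`: induction handles the kernel of `c ^ n`, while its range lies in
  -- `L·V`. The latter needs `n ≥ 1`.
  obtain ⟨n, hn0, hn⟩ := ((Filter.eventually_ge_atTop 1).and
    c.eventually_isCompl_ker_pow_range_pow).exists
  have hcn (k : ℕ) (x : L) (v : V) : (c ^ k) ⁅x, v⁆ = ⁅x, (c ^ k) v⁆ := by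
    induction k with
    | zero => rfl
    | succ k ih => rw [pow_succ', Module.End.mul_apply, ih, hc, Module.End.mul_apply]
  let K : LieSubmodule F L V :=
    { LinearMap.ker (c ^ n) with
      lie_mem := by
        intro x v hv
        have hv' : (c ^ n) v = 0 := hv
        change (c ^ n) ⁅x, v⁆ = 0
        rw [hcn, hv', lie_zero] }
  have hK : finrank F K < finrank F V := by
    refine Submodule.finrank_lt fun hK => hnil ⟨n, ?_⟩
    exact LinearMap.ker_eq_top.1 hK
  have hK' := ih _ hK (V := K) rfl
  refine top_unique fun v _ => ?_
  obtain ⟨k, hk, w, ⟨u, rfl⟩, rfl⟩ := Submodule.mem_sup.1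
    (hn.sup_eq_top ▸ Submodule.mem_top : v ∈ LinearMap.ker (c ^ n) ⊔ LinearMap.range (c ^ n))
  refine add_mem ?_ (LieSubmodule.mem_sup_right ?_)
  · obtain ⟨t, ht, s, hs, hts⟩ := (LieSubmodule.mem_sup _ _ _).1
      (hK' ▸ LieSubmodule.mem_top (⟨k, hk⟩ : K))
    have hk' : k = (t : V) + s := congrArg Subtype.val hts.symm
    rw [hk']
    refine add_mem (LieSubmodule.mem_sup_left ?_) (LieSubmodule.mem_sup_right ?_)
    · rw [mem_maxTrivSubmodule] at ht ⊢
      exact fun x => congrArg Subtype.val (ht x)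
    · have h1 := LieSubmodule.mem_map_of_mem (f := K.incl) hs
      rw [LieSubmodule.map_bracket_eq] at h1
      exact LieSubmodule.mono_lie_right _ le_top h1
  · obtain ⟨m, rfl⟩ : ∃ m, n = m + 1 := ⟨n - 1, by omega⟩
    rw [pow_succ', Module.End.mul_apply]
    exact hcL _

end Weyl

/-! ### Semisimple ideal plus semisimple centre implies complemented. -/

section Reductive

open LieModule LieAlgebra Module

/-- An equivariant projection onto an invariant subspace, commuting with a set of
endomorphisms that commute with the action. -/
theorem exists_equivariant_projection {F L V : Type*} [Field F] [CharZero F] [LieRing L]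
    [LieAlgebra F L] [FiniteDimensional F L] [IsKilling F L]
    [AddCommGroup V] [Module F V] [LieRingModule L V] [LieModule F L V] [FiniteDimensional F V]
    (S : Set (Module.End F V)) (hS : ∀ a ∈ S, ∀ (x : L) (v : V), a ⁅x, v⁆ = ⁅x, a v⁆)
    (N : LieSubmodule F L V) (p : V →ₗ[F] V) (hp : ∀ a ∈ S, ∀ v, p (a v) = a (p v))
    (hpN : ∀ v, p v ∈ N) (hpid : ∀ v ∈ N, p v = v) :
    ∃ t : V →ₗ[F] V, (∀ (x : L) (v : V), t ⁅x, v⁆ = ⁅x, t v⁆) ∧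
      (∀ a ∈ S, ∀ v, t (a v) = a (t v)) ∧ (∀ v, t v ∈ N) ∧ ∀ v ∈ N, t v = v := by
  -- `L` sends `H` into the maps vanishing on `N` (`W` below). So the invariant part of `p` in `H =
  -- H^L + L·H` still restricts to the identity on `N`.
  let H : LieSubmodule F L (V →ₗ[F] V) :=
    { carrier := {f | (∀ a ∈ S, ∀ v, f (a v) = a (f v)) ∧ (∀ v, f v ∈ N) ∧
        ∃ c : F, ∀ v ∈ N, f v = c • v}
      add_mem' := by
        rintro f g ⟨hf1, hf2, c, hc⟩ ⟨hg1, hg2, d, hd⟩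
        refine ⟨fun a ha v => ?_, fun v => add_mem (hf2 v) (hg2 v), c + d, fun v hv => ?_⟩
        · simp [hf1 a ha, hg1 a ha]
        · simp [hc v hv, hd v hv, add_smul]
      zero_mem' := ⟨by simp, by simp, 0, by simp⟩
      smul_mem' := by
        rintro b f ⟨hf1, hf2, c, hc⟩
        refine ⟨fun a ha v => ?_, fun v => Submodule.smul_mem N.toSubmodule b (hf2 v), b * c,
          fun v hv => ?_⟩
        · simp [hf1 a ha]
        · simp [hc v hv, mul_smul]
      lie_mem := by
        rintro x f ⟨hf1, hf2, c, hc⟩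
        refine ⟨fun a ha v => ?_, fun v => ?_, 0, fun v hv => ?_⟩
        · simp [hf1 a ha, ← hS a ha]
        · rw [LieHom.lie_apply]
          exact sub_mem (N.lie_mem (hf2 v)) (hf2 _)
        · simp [hc v hv, hc _ (N.lie_mem hv)] }
  let W : LieSubmodule F L H :=
    { carrier := {f | ∀ v ∈ N, (f : V →ₗ[F] V) v = 0}
      add_mem' := fun {f g} hf hg v hv => by simp [hf v hv, hg v hv]
      zero_mem' := by simp
      smul_mem' := fun b f hf v hv => by simp [hf v hv]
      lie_mem := fun {x f} hf v hv => by simp [hf v hv, hf _ (N.lie_mem hv)] }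
  have hW : ⁅(⊤ : LieIdeal F L), (⊤ : LieSubmodule F L H)⁆ ≤ W := by
    refine (LieSubmodule.lie_le_iff _ _ _).2 fun x _ f _ v hv => ?_
    obtain ⟨-, -, c, hc⟩ := f.2
    simp [hc v hv, hc _ (N.lie_mem hv)]
  have hpH : p ∈ H := ⟨hp, hpN, 1, by simpa using hpid⟩
  obtain ⟨t, ht, s, hs, hts⟩ := (LieSubmodule.mem_sup _ _ _).1
    (maxTrivSubmodule_sup_lie_eq_top (F := F) (L := L) (V := H) ▸
      LieSubmodule.mem_top (⟨p, hpH⟩ : H))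
  refine ⟨t, fun x v => ?_, t.2.1, t.2.2.1, fun v hv => ?_⟩
  · have h := LinearMap.congr_fun (congrArg Subtype.val ((mem_maxTrivSubmodule F L H t).1 ht x)) v
    exact (sub_eq_zero.1 (by simpa using h)).symm
  · have h := LinearMap.congr_fun (congrArg Subtype.val hts) v
    have hs0 : (s : V →ₗ[F] V) v = 0 := hW hs v hv
    simpa [hs0, hpid v hv] using h

theorem isSemisimple_of_mem_adjoin {F V : Type*} [Field F] [PerfectField F] [AddCommGroup V]
    [Module F V] [FiniteDimensional F V] {S : Set (Module.End F V)}
    (hcomm : ∀ a ∈ S, ∀ b ∈ S, a * b = b * a) (hS : ∀ a ∈ S, a.IsSemisimple) {a : Module.End F V}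
    (ha : a ∈ Algebra.adjoin F S) : a.IsSemisimple := by
  have hc {a b : Module.End F V} (ha : a ∈ Algebra.adjoin F S) (hb : b ∈ Algebra.adjoin F S) :
      Commute a b :=
    congrArg Subtype.val ((Algebra.isMulCommutative_adjoin F hcomm).is_comm.comm ⟨a, ha⟩ ⟨b, hb⟩)
  induction ha using Algebra.adjoin_induction with
  | mem a ha => exact hS a ha
  | algebraMap c =>
    rw [Algebra.algebraMap_eq_smul_one]
    exact Module.End.IsSemisimple_smul c Module.End.isSemisimple_id
  | add a b ha hb iha ihb => exact iha.add_of_commute (hc ha hb) ihb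
  | mul a b ha hb iha ihb => exact iha.mul_of_commute (hc ha hb) ihb

/-- A commuting family of semisimple endomorphisms has commuting projections onto its invariant
subspaces. -/
theorem exists_commuting_projection {F V : Type*} [Field F] [PerfectField F] [AddCommGroup V]
    [Module F V] [FiniteDimensional F V] {S : Set (Module.End F V)}
    (hcomm : ∀ a ∈ S, ∀ b ∈ S, a * b = b * a) (hS : ∀ a ∈ S, a.IsSemisimple)
    (N : Submodule F V) (hN : ∀ a ∈ S, ∀ v ∈ N, a v ∈ N) :
    ∃ p : V →ₗ[F] V, (∀ a ∈ S, ∀ v, p (a v) = a (p v)) ∧ (∀ v, p v ∈ N) ∧ ∀ v ∈ N, p v = v := by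
  let C := Algebra.adjoin F S
  let : CommRing C :=
    { (inferInstance : Ring C) with
      mul_comm := (Algebra.isMulCommutative_adjoin F hcomm).is_comm.comm }
  -- Every element of `C` is semisimple, so a nilpotent one is zero. A reduced commutative artinian
  -- ring is semisimple, so `C`-submodules have complements.
  have : IsReduced C := ⟨fun a ⟨n, hn⟩ => Subtype.ext <|
    Module.End.eq_zero_of_isNilpotent_isSemisimple ⟨n, congrArg Subtype.val hn⟩
      (isSemisimple_of_mem_adjoin hcomm hS a.2)⟩
  have : IsArtinianRing C := IsArtinianRing.of_finite F C
  have : IsSemisimpleRing C := IsArtinianRing.isSemisimpleRing_of_isReduced C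
  let N' : Submodule C V :=
    { N with
      smul_mem' := by
        rintro ⟨c, hc⟩ v hv
        change c v ∈ N
        induction hc using Algebra.adjoin_induction generalizing v with
        | mem a ha => exact hN a ha v hv
        | algebraMap c => exact N.smul_mem c hv
        | add a b _ _ iha ihb => exact N.add_mem (iha hv) (ihb hv)
        | mul a b _ _ iha ihb => exact iha (ihb hv) }
  obtain ⟨Q, hQ⟩ := exists_isCompl N'
  let p := N'.subtype ∘ₗ N'.projectionOnto Q hQ
  refine ⟨p.restrictScalars F, fun a ha v => p.map_smul ⟨a, Algebra.subset_adjoin ha⟩ v,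
    fun v => (N'.projectionOnto Q hQ v).2, fun v hv => ?_⟩
  exact congrArg Subtype.val (Submodule.projectionOnto_apply_left hQ (⟨v, hv⟩ : N'))

theorem IsSemisimpleMap.isSemisimple {F M : Type*} [Field F] [PerfectField F] [AddCommGroup M]
    [Module F M] {f : Module.End F M} (hf : IsSemisimpleMap f) : f.IsSemisimple := by
  obtain ⟨s, hs, hcop, hmin⟩ := hf
  refine Module.End.isSemisimple_of_squarefree_aeval_eq_zero ?_ (minpoly.aeval F f)
  rw [hmin]
  refine Finset.squarefree_prod_of_pairwise_isCoprime (fun p hp q hq hpq => ?_)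
    fun p hp => (hs p hp).squarefree
  exact (hcop hp hq hpq).isRelPrime

variable {F M : Type*} [Field F] [AddCommGroup M] [Module F M]
  {Ω : LieSubalgebra F (Module.End F M)}

theorem center_apply_comm {z : Ω} (hz : z ∈ center F Ω) (f : Ω) (m : M) :
    (z : Module.End F M) ((f : Module.End F M) m) =
      (f : Module.End F M) ((z : Module.End F M) m) := by
  have h := congrArg Subtype.val ((mem_maxTrivSubmodule F Ω Ω z).1 hz f)
  have h' := LinearMap.congr_fun h m
  simp [Ring.lie_def, sub_eq_zero] at h'
  exact h'.symm

theorem SemisimplePlusCentre.complementedLattice [CharZero F] [FiniteDimensional F M]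
    (h : SemisimplePlusCentre Ω) : ComplementedLattice (Sub Ω) := by
  obtain ⟨⟨Ω₁, hrad, hcompl⟩, hss⟩ := h
  refine ⟨fun N => ?_⟩
  let S : Set (Module.End F M) := Subtype.val '' (center F Ω : Set Ω)
  obtain ⟨p, hp1, hp2, hp3⟩ := exists_commuting_projection (S := S)
    (by
      rintro _ ⟨a, ha, rfl⟩ _ ⟨b, -, rfl⟩
      exact LinearMap.ext fun m => center_apply_comm ha b m)
    (by rintro _ ⟨a, ha, rfl⟩; exact (hss a ha).isSemisimple)
    N.toSubmodule (by rintro _ ⟨a, -, rfl⟩ m hm; exact mem_of_mem a.2 hm)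
  let N₁ : LieSubmodule F Ω₁ M :=
    { N.toSubmodule with lie_mem := fun {x _} hm => N.lie_mem (x := x.1) hm }
  obtain ⟨t, ht1, ht2, ht3, ht4⟩ := exists_equivariant_projection (L := Ω₁) S
    (by rintro _ ⟨a, ha, rfl⟩ x m; exact center_apply_comm ha x.1 m) N₁ p hp1 hp2 hp3
  have ht (f : Ω) (m : M) : t ⁅f, m⁆ = ⁅f, t m⁆ := by
    obtain ⟨x, hx, a, ha, rfl⟩ := Submodule.mem_sup.1
      (hcompl.sup_eq_top ▸ Submodule.mem_top : f ∈ Ω₁.toSubmodule ⊔ (center F Ω).toSubmodule)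
    rw [add_lie, add_lie, map_add]
    exact congrArg₂ _ (ht1 ⟨x, hx⟩ m) (ht2 _ ⟨a, ha, rfl⟩ m)
  let K : Sub Ω :=
    { LinearMap.ker t with
      lie_mem := by
        intro x v hv
        have hv' : t v = 0 := hv
        change t ⁅x, v⁆ = 0
        rw [ht, hv', lie_zero] }
  refine ⟨K, ?_, ?_⟩
  · rw [disjoint_iff, eq_bot_iff]
    rintro m ⟨hm1, hm2⟩
    have : t m = 0 := hm2
    exact (ht4 m hm1).symm.trans this
  · rw [codisjoint_iff, eq_top_iff]
    intro m _
    refine (LieSubmodule.mem_sup _ _ _).2 ⟨t m, ht3 m, m - t m, ?_, by abel⟩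
    change t (m - t m) = 0
    rw [map_sub, ht4 _ (ht3 m), sub_self]

end Reductive

/-! ### Complete reducibility implies semisimple ideal plus semisimple centre. -/

section CompletelyReducible

open LieModule LieAlgebra Module Polynomial

theorem isNilpotent_of_trace_mul_aeval_eq_zero {F V : Type*} [Field F] [CharZero F]
    [AddCommGroup V] [Module F V] [FiniteDimensional F V] (z : Module.End F V)
    (h : ∀ p : F[X], LinearMap.trace F V (z * aeval z p) = 0) : IsNilpotent z := by
  obtain ⟨g, hg, hdvd⟩ := exists_eq_pow_rootMultiplicity_mul_and_not_dvd (minpoly F z)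
    (minpoly.ne_zero (Algebra.IsIntegral.isIntegral z)) 0
  rw [map_zero, sub_zero] at hg hdvd
  set n := (minpoly F z).rootMultiplicity 0
  -- The Fitting idempotent `u X^(n+1)` at `z`. The exponent `n + 1` leaves a factor `z` even when
  -- `n = 0`, so its trace vanishes by `h`; in characteristic zero it is then zero.
  obtain ⟨u, v, huv⟩ : IsCoprime (X ^ (n + 1)) g :=
    (((irreducible_X (R := F)).coprime_iff_not_dvd).2 hdvd).pow_left
  have hz : aeval z (X ^ (n + 1) * g) = 0 := by
    rw [pow_succ', mul_assoc, ← hg, map_mul, minpoly.aeval, mul_zero]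
  have h1 : aeval z (u * X ^ (n + 1)) + aeval z (v * g) = 1 := by
    rw [← map_add, huv, map_one]
  have hidem : IsIdempotentElem (aeval z (u * X ^ (n + 1))) := by
    have h0 : aeval z (u * X ^ (n + 1)) * aeval z (v * g) = 0 := by
      rw [← map_mul, show u * X ^ (n + 1) * (v * g) = u * v * (X ^ (n + 1) * g) by ring,
        map_mul, hz, mul_zero]
    rw [eq_sub_of_add_eq' h1, mul_sub, mul_one, sub_eq_zero] at h0
    exact h0.symm
  have he : aeval z (u * X ^ (n + 1)) = z * aeval z (u * X ^ n) := by
    rw [show u * X ^ (n + 1) = X * (u * X ^ n) by ring, map_mul, aeval_X]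
  have h0 : aeval z (u * X ^ (n + 1)) = 0 :=
    LinearMap.IsIdempotentElem.eq_zero_of_trace_eq_zero hidem (he ▸ h _)
  rw [h0, zero_add] at h1
  refine ⟨n + 1, ?_⟩
  have h2 : aeval z (X ^ (n + 1) * g * v) = z ^ (n + 1) := by
    rw [mul_assoc, mul_comm g, map_mul, h1, mul_one, map_pow, aeval_X]
  rw [← h2, map_mul, hz, zero_mul]

theorem isSemisimpleMap_of_squarefree {F M : Type*} [Field F] [AddCommGroup M] [Module F M]
    [FiniteDimensional F M] {f : Module.End F M} (hf : Squarefree (minpoly F f)) :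
    IsSemisimpleMap f := by
  classical
  open UniqueFactorizationMonoid in
  have hmon := minpoly.monic (Algebra.IsIntegral.isIntegral (R := F) f)
  refine ⟨(normalizedFactors (minpoly F f)).toFinset, fun p hp => ?_, fun p hp q hq hpq => ?_, ?_⟩
  · exact irreducible_of_normalized_factor p (Multiset.mem_toFinset.1 hp)
  · have hp' := Multiset.mem_toFinset.1 hp
    have hq' := Multiset.mem_toFinset.1 hq
    rw [(irreducible_of_normalized_factor p hp').coprime_iff_not_dvd]
    intro hdvd
    have hass := (irreducible_of_normalized_factor p hp').associated_of_dvd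
      (irreducible_of_normalized_factor q hq') hdvd
    exact hpq (by
      rw [← normalize_normalized_factor p hp', ← normalize_normalized_factor q hq']
      exact normalize_eq_normalize hass.dvd hass.symm.dvd)
  · have hnd := (squarefree_iff_nodup_normalizedFactors hmon.ne_zero).1 hf
    have hprod := leadingCoeff_mul_prod_normalizedFactors (minpoly F f)
    rw [hmon.leadingCoeff, map_one, one_mul] at hprod
    rw [Finset.prod, Multiset.toFinset_val, hnd.dedup, Multiset.map_id', hprod]

variable {F M : Type*} [Field F] [AddCommGroup M] [Module F M]
  {Ω : LieSubalgebra F (Module.End F M)}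

/-- In a completely reducible representation an ideal acting by nilpotent maps is zero. -/
theorem eq_bot_of_forall_isNilpotent [FiniteDimensional F M] [ComplementedLattice (Sub Ω)]
    (J : LieIdeal F Ω) (hJ : ∀ z ∈ J, IsNilpotent (z : Module.End F M)) : J = ⊥ := by
  have hn : LieModule.IsNilpotent J M :=
    (isNilpotent_iff_forall' (R := F)).2 fun z => hJ z z.2
  obtain ⟨k, hk⟩ := LieModule.IsNilpotent.nilpotent F J M
  set N : Sub Ω := ⁅J, (⊤ : Sub Ω)⁆ with hN
  obtain ⟨P, hP⟩ := exists_isCompl N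
  -- On the complement `P`, `J` acts into `N ⊓ P = ⊥`, so `J·M = J·N`; nilpotency then forces `J·M =
  -- 0`.
  have hNN : N ≤ ⁅J, N⁆ := by
    refine (LieSubmodule.lie_le_iff _ _ _).2 fun x hx m _ => ?_
    obtain ⟨n, hn, p, hp, rfl⟩ := (LieSubmodule.mem_sup _ _ _).1
      (hP.sup_eq_top ▸ LieSubmodule.mem_top m : m ∈ N ⊔ P)
    have h0 := hP.disjoint.le_bot ((LieSubmodule.mem_inf _ _ _).2
      ⟨LieSubmodule.lie_mem_lie hx (LieSubmodule.mem_top p), P.lie_mem (x := x) hp⟩)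
    rw [lie_add, (LieSubmodule.mem_bot _).1 h0, add_zero]
    exact LieSubmodule.lie_mem_lie hx hn
  have hle (k : ℕ) : N ≤ J.lcs M k := by
    induction k with
    | zero => simp
    | succ k ih => rw [LieIdeal.lcs_succ]; exact hNN.trans (LieSubmodule.mono_lie_right J ih)
  have hbot : J.lcs M k = ⊥ := by
    rw [← LieSubmodule.toSubmodule_eq_bot, LieIdeal.coe_lcs_eq, hk]
    rfl
  rw [eq_bot_iff]
  intro z hz
  refine (LieSubmodule.mem_bot _).2 (Subtype.ext (LinearMap.ext fun m => ?_))
  have := hle k (LieSubmodule.lie_mem_lie hz (LieSubmodule.mem_top m))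
  rw [hbot] at this
  exact (LieSubmodule.mem_bot _).1 this

theorem trace_mul_eq_zero_of_mem_lie {I : LieIdeal F Ω} {z : Ω}
    (hz : z ∈ ⁅(⊤ : LieIdeal F Ω), I⁆) {b : Module.End F M}
    (hb : ∀ a ∈ I, Commute (a : Module.End F M) b) :
    LinearMap.trace F M ((z : Module.End F M) * b) = 0 := by
  rw [← LieSubmodule.mem_toSubmodule, LieSubmodule.lieIdeal_oper_eq_linear_span'] at hz
  induction hz using Submodule.span_induction with
  | mem z hz =>
    obtain ⟨x, -, a, ha, rfl⟩ := hz
    rw [LieSubalgebra.coe_bracket, Ring.lie_def, sub_mul, map_sub, mul_assoc, (hb a ha).eq,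
      ← mul_assoc, LinearMap.trace_mul_cycle, sub_self]
  | zero => simp
  | add x y _ _ hx hy => simp [add_mul, hx, hy]
  | smul a x _ hx => simp [hx]

/-- Each `z ∈ J` commutes with `I`, as does every `p(z)`. Being in `[Ω, I]`, `z` satisfies `tr (z
p(z)) = 0` for all `p`, so it is nilpotent. -/
theorem eq_bot_of_le_lie [CharZero F] [FiniteDimensional F M] [ComplementedLattice (Sub Ω)]
    {I J : LieIdeal F Ω} (hJ : J ≤ ⁅(⊤ : LieIdeal F Ω), I⁆) (hIJ : ⁅I, J⁆ = ⊥) : J = ⊥ := by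
  refine eq_bot_of_forall_isNilpotent J fun z hz => ?_
  refine isNilpotent_of_trace_mul_aeval_eq_zero _ fun p =>
    trace_mul_eq_zero_of_mem_lie (hJ hz) fun a ha => ?_
  have h := congrArg Subtype.val ((LieSubmodule.lie_eq_bot_iff _ _).1 hIJ a ha z hz)
  have hc : Commute (a : Module.End F M) z := sub_eq_zero.1 h
  exact Algebra.commute_of_mem_adjoin_singleton_of_commute (aeval_mem_adjoin_singleton F _) hc

theorem isSemisimpleMap_of_mem_center [FiniteDimensional F M] [ComplementedLattice (Sub Ω)]
    {a : Ω} (ha : a ∈ center F Ω) :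
    IsSemisimpleMap (a : Module.End F M) := by
  refine isSemisimpleMap_of_squarefree fun q ⟨r, hr⟩ => ?_
  -- If `q²` divides the minimal polynomial, `n` squares to zero. It kills its range, and also a
  -- complement of that range, so `n = 0` and `q` is a unit.
  set n := aeval (a : Module.End F M) (q * r) with hn
  have hnn : n * n = 0 := by
    rw [hn, ← map_mul, show q * r * (q * r) = q * q * r * r by ring, ← hr, map_mul,
      minpoly.aeval, zero_mul]
  have hnf (f : Ω) (m : M) : n ((f : Module.End F M) m) = (f : Module.End F M) (n m) := by
    have h : Commute (f : Module.End F M) a :=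
      LinearMap.ext fun m => (center_apply_comm ha f m).symm
    exact (LinearMap.congr_fun (Algebra.commute_of_mem_adjoin_singleton_of_commute
      (aeval_mem_adjoin_singleton F _) h).eq m).symm
  let R : Sub Ω :=
    { LinearMap.range n with
      lie_mem := by
        rintro f _ ⟨m, rfl⟩
        exact ⟨(f : Module.End F M) m, hnf f m⟩ }
  obtain ⟨P, hP⟩ := exists_isCompl R
  have hnP (m : M) (hm : m ∈ P) : n m ∈ P :=
    aeval_apply_smul_mem_of_le_comap (q := P.toSubmodule) hm _ _ fun m hm => mem_of_mem a.2 hm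
  have hn0 : n = 0 := by
    ext m
    obtain ⟨_, ⟨m, rfl⟩, p, hp, rfl⟩ := (LieSubmodule.mem_sup _ _ _).1
      (hP.sup_eq_top ▸ LieSubmodule.mem_top m : m ∈ R ⊔ P)
    have h0 := hP.disjoint.le_bot ((LieSubmodule.mem_inf _ _ _).2 ⟨⟨p, rfl⟩, hnP p hp⟩)
    rw [map_add, (LieSubmodule.mem_bot _).1 h0, add_zero, ← Module.End.mul_apply, hnn]
    rfl
  have hdvd := minpoly.dvd F _ hn0
  rw [hr, mul_assoc] at hdvd
  have hqr : q * r ≠ 0 := fun h0 => minpoly.ne_zero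
    (Algebra.IsIntegral.isIntegral (R := F) (a : Module.End F M))
    (by rw [hr, mul_assoc, h0, mul_zero])
  exact isUnit_of_dvd_one ((mul_dvd_mul_iff_right hqr).1 (by rwa [one_mul]))

variable [CharZero F] [FiniteDimensional F M] [ComplementedLattice (Sub Ω)]

theorem le_center_of_lie_self_eq_bot {I : LieIdeal F Ω} (hI : ⁅I, I⁆ = ⊥) :
    I ≤ center F Ω := by
  have h : ⁅(⊤ : LieIdeal F Ω), I⁆ = ⊥ := by
    refine eq_bot_of_le_lie le_rfl (I := I) (eq_bot_iff.2 ?_)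
    exact (LieSubmodule.mono_lie_right _ (LieSubmodule.lie_le_right _ _)).trans hI.le
  intro a ha
  exact (mem_maxTrivSubmodule F Ω Ω a).2 fun x =>
    (LieSubmodule.lie_eq_bot_iff _ _).1 h x (LieSubmodule.mem_top x) a ha

theorem disjoint_center_lie : Disjoint (center F Ω) ⁅(⊤ : LieIdeal F Ω), (⊤ : LieIdeal F Ω)⁆ := by
  rw [disjoint_iff]
  refine eq_bot_of_le_lie (I := ⊤) inf_le_right ((LieSubmodule.lie_eq_bot_iff _ _).2 ?_)
  rintro x - m ⟨hm, -⟩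
  exact (mem_maxTrivSubmodule F Ω Ω m).1 hm x

theorem lie_self_eq_bot_of_isSolvable (I : LieIdeal F Ω) [IsSolvable I] : ⁅I, I⁆ = ⊥ := by
  obtain ⟨k, hk⟩ := IsSolvable.solvable F I
  rw [LieIdeal.derivedSeries_eq_bot_iff] at hk
  induction k with
  | zero =>
    rw [derivedSeriesOfIdeal_zero] at hk
    rw [hk, LieSubmodule.lie_bot]
  | succ k ih =>
    -- The descent stops at `[I, I]`, since `I` itself need not lie in `[Ω, Ω]`.
    rcases k with - | k
    · simpa [derivedSeriesOfIdeal_succ] using hk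
    refine ih ?_
    rw [derivedSeriesOfIdeal_succ] at hk
    have h2 : derivedSeriesOfIdeal F Ω (k + 1) I ≤ ⁅(⊤ : LieIdeal F Ω), (⊤ : LieIdeal F Ω)⁆ := by
      rw [derivedSeriesOfIdeal_succ]
      exact LieSubmodule.mono_lie le_top le_top
    exact le_bot_iff.1 (disjoint_center_lie (le_center_of_lie_self_eq_bot hk) h2)

theorem radical_le_center : radical F Ω ≤ center F Ω :=
  le_center_of_lie_self_eq_bot (lie_self_eq_bot_of_isSolvable _)

theorem isCompl_lie_center :
    IsCompl ⁅(⊤ : LieIdeal F Ω), (⊤ : LieIdeal F Ω)⁆.toSubmodule (center F Ω).toSubmodule := by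
  set D := ⁅(⊤ : LieIdeal F Ω), (⊤ : LieIdeal F Ω)⁆ with hD
  have hd : Disjoint D.toSubmodule (center F Ω).toSubmodule :=
    LieSubmodule.disjoint_toSubmodule.2 disjoint_center_lie.symm
  -- For `x` Killing-orthogonal to `D`, `⁅y, x⁆` lies in the Killing radical, hence in the centre,
  -- and also in `D`; so it is zero. The dimension formula for orthogonals then shows that `D` and
  -- the centre span `Ω`.
  have hK : LieIdeal.killingCompl F Ω D ≤ center F Ω := by
    intro x hx
    rw [LieIdeal.mem_killingCompl] at hx
    refine (mem_maxTrivSubmodule F Ω Ω x).2 fun y => ?_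
    have h1 : ⁅y, x⁆ ∈ D := LieSubmodule.lie_mem_lie (LieSubmodule.mem_top y) (LieSubmodule.mem_top x)
    have h2 : ⁅y, x⁆ ∈ LieIdeal.killingCompl F Ω ⊤ := by
      rw [LieIdeal.mem_killingCompl]
      intro z _
      rw [← LieModule.traceForm_apply_lie_apply]
      exact hx _ (LieSubmodule.lie_mem_lie (LieSubmodule.mem_top z) (LieSubmodule.mem_top y))
    simpa using disjoint_center_lie.le_bot ((LieSubmodule.mem_inf _ _ _).2
      ⟨radical_le_center (killingCompl_top_le_radical F Ω h2), h1⟩)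
  refine ⟨hd, codisjoint_iff.2 (Submodule.eq_top_of_disjoint _ _ ?_ hd)⟩
  have h1 := LinearMap.BilinForm.finrank_add_finrank_orthogonal' (B := killingForm F Ω) D.toSubmodule
  have h2 : finrank F ((killingForm F Ω).orthogonal D.toSubmodule) ≤
    finrank F (center F Ω).toSubmodule := Submodule.finrank_mono hK
  omega

theorem hasTrivialRadical_lie :
    HasTrivialRadical F (⁅(⊤ : LieIdeal F Ω), (⊤ : LieIdeal F Ω)⁆ : LieIdeal F Ω) := by
  set D := ⁅(⊤ : LieIdeal F Ω), (⊤ : LieIdeal F Ω)⁆ with hD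
  rw [hasTrivialRadical_iff_no_abelian_ideals]
  intro I hI
  -- The centre acts trivially on `I`, so an abelian ideal of `D` is an ideal of `Ω`; it is then
  -- central and inside `D`, hence zero.
  let I' : LieIdeal F Ω :=
    { I.toSubmodule.map D.toSubmodule.subtype with
      lie_mem := by
        rintro x _ ⟨i, hi, rfl⟩
        obtain ⟨d, hd, a, ha, rfl⟩ := Submodule.mem_sup.1 ((isCompl_lie_center (Ω := Ω)).sup_eq_top ▸
          Submodule.mem_top : x ∈ D.toSubmodule ⊔ (center F Ω).toSubmodule)
        have h0 : ⁅a, (i : Ω)⁆ = 0 := by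
          rw [← lie_skew, (mem_maxTrivSubmodule F Ω Ω a).1 ha, neg_zero]
        refine ⟨⁅(⟨d, hd⟩ : D), i⁆, I.lie_mem hi, ?_⟩
        change ⁅d, (i : Ω)⁆ = ⁅d + a, (i : Ω)⁆
        rw [add_lie, h0, add_zero] }
  have hI' : I' = ⊥ := by
    refine le_bot_iff.1 (disjoint_center_lie (le_center_of_lie_self_eq_bot ?_) ?_)
    · rw [LieSubmodule.lie_eq_bot_iff]
      rintro _ ⟨i, hi, rfl⟩ _ ⟨j, hj, rfl⟩
      exact congrArg (fun x : I => ((x : D) : Ω)) (hI.trivial ⟨i, hi⟩ ⟨j, hj⟩)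
    · rintro _ ⟨i, hi, rfl⟩
      exact i.2
  rw [eq_bot_iff]
  intro i hi
  have : (i : Ω) ∈ I' := ⟨i, hi, rfl⟩
  rw [hI'] at this
  exact Subtype.ext ((LieSubmodule.mem_bot _).1 this)

theorem semisimplePlusCentre : SemisimplePlusCentre Ω :=
  ⟨⟨_, hasTrivialRadical_lie, isCompl_lie_center⟩, fun _ => isSemisimpleMap_of_mem_center⟩

end CompletelyReducible

/-! ### Assembling the equivalences and the cube structure. -/

theorem isBooleanLattice_of_orderIso_set {α ι : Type*} [Lattice α] [BoundedOrder α]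
    (e : α ≃o Set ι) : IsBooleanLattice α :=
  ⟨e.symm.complementedLattice, fun a b c => e.injective (by
    simp only [e.map_inf, e.map_sup]; exact inf_sup_left _ _ _)⟩

end LieLinear

theorem mainTheorem7 {F M : Type*} [Field F] [CharZero F] [AddCommGroup M] [Module F M]
    [FiniteDimensional F M] (Ω : LieSubalgebra F (Module.End F M)) :
    List.TFAE [
      Finite (LieLinear.Sub Ω) ∧ LieLinear.IsBooleanLattice (LieLinear.Sub Ω),
      Finite (LieLinear.Sub Ω) ∧ ComplementedLattice (LieLinear.Sub Ω),
      LieLinear.CompletelyReducible Ω ∧ LieLinear.NoIsoIrred Ω,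
      LieLinear.SemisimplePlusCentre Ω ∧ LieLinear.NoIsoIrred Ω] ∧
    (Finite (LieLinear.Sub Ω) ∧ LieLinear.IsBooleanLattice (LieLinear.Sub Ω) →
      ∃ (r : ℕ) (N : Fin r → LieLinear.Sub Ω),
        LieLinear.IsDecomposition N ∧
        (∀ (s : ℕ) (P : Fin s → LieLinear.Sub Ω), LieLinear.IsDecomposition P →
          ∃ e : Fin s ≃ Fin r, ∀ i, P i = N (e i)) ∧
        (Set.univ : Set (LieLinear.Sub Ω)) = Set.range (fun I : Finset (Fin r) => ⨆ i ∈ I, N i) ∧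
        Nonempty (LieLinear.Sub Ω ≃o Set (Fin r))) := by
  have hstruct (h : LieLinear.CompletelyReducible Ω ∧ LieLinear.NoIsoIrred Ω) :
      ∃ (r : ℕ) (N : Fin r → LieLinear.Sub Ω), LieLinear.IsDecomposition N :=
    LieLinear.exists_isDecomposition h.1 h.2
  have hab : Finite (LieLinear.Sub Ω) ∧ LieLinear.IsBooleanLattice (LieLinear.Sub Ω) →
      Finite (LieLinear.Sub Ω) ∧ ComplementedLattice (LieLinear.Sub Ω) := fun h => ⟨h.1, h.2.1⟩
  have hbc : Finite (LieLinear.Sub Ω) ∧ ComplementedLattice (LieLinear.Sub Ω) →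
      LieLinear.CompletelyReducible Ω ∧ LieLinear.NoIsoIrred Ω := by
    rintro ⟨_, _⟩
    exact ⟨LieLinear.completelyReducible_of_complementedLattice, LieLinear.noIsoIrred_of_finite⟩
  refine ⟨?_, fun h => ?_⟩
  · tfae_have 1 → 2 := hab
    tfae_have 2 → 3 := hbc
    tfae_have 3 → 1 := by
      intro h
      obtain ⟨r, N, hN⟩ := hstruct h
      have e := hN.orderIso h.2
      exact ⟨Finite.of_injective e e.injective, LieLinear.isBooleanLattice_of_orderIso_set e⟩
    tfae_have 3 → 4 := by
      rintro ⟨h, hΩ⟩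
      have := h.complementedLattice
      exact ⟨LieLinear.semisimplePlusCentre, hΩ⟩
    tfae_have 4 → 3 := by
      rintro ⟨h, hΩ⟩
      have := h.complementedLattice
      exact ⟨LieLinear.completelyReducible_of_complementedLattice, hΩ⟩
    tfae_finish
  · have h3 := hbc (hab h)
    obtain ⟨r, N, hN⟩ := hstruct h3
    refine ⟨r, N, hN, fun s P hP => hN.exists_equiv h3.2 hP, ?_, ⟨hN.orderIso h3.2⟩⟩
    classical
    refine (Set.eq_univ_of_forall fun A => ?_).symm
    refine ⟨((hN.orderIso h3.2) A).toFinset, ?_⟩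
    simp only [Set.mem_toFinset]
    exact (hN.orderIso h3.2).symm_apply_apply A
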